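/- Let $q\ge 1$, $P\in\mathbb{R}^{q\times n}$, $A\in\mathbb{R}^{m\times n}$, $b\in\mathbb{R}^m$, and let $e=(1,\dots,1)^{\intercal}\in\mathbb{R}^q$. Put $$S=\{x\in\mathbb{R}^n\mid Ax\ge b\},\qquad \mathcal{P}=P[S]+\mathbb{R}^q_+,$$ $$T=\{(u,w)\in\mathbb{R}^m\times\mathbb{R}^q\mid A^{\intercal}u=P^{\intercal}w,\ (u,w)\ge 0,\ e^{\intercal}w=1\},$$ $K=\{y\in\mathbb{R}^q\mid y_1=\dots=y_{q-1}=0,\ y_q\ge 0\}$, and $$\mathcal{D}=\{(w_1,\dots,w_{q-1},b^{\intercal}u)\mid (u,w)\in T\}-K\subseteq\mathbb{R}^q,\qquad \bar{\mathcal{D}}=\{(w_1,\dots,w_q,b^{\intercal}u)\mid (u,w)\in T\}-\mathbb{R}^{q+1}_+\subseteq\mathbb{R}^{q+1}.$$ For $y,y^*\in\mathbb{R}^q$ let $\varphi(y,y^*)=\sum_{i=1}^{q-1}y_iy^*_i+y_q\bigl(1-\sum_{i=1}^{q-1}y^*_i\bigr)-y^*_q\in\mathbb{R}$, and for $F,F^*\subseteq\mathbb{R}^q$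 put $$\Psi(F^*)=\{y\in\mathcal{P}\mid \varphi(y,y^*)=0\text{ for all }y^*\in F^*\},\qquad \Psi^{-1}(F)=\{y^*\in\mathcal{D}\mid \varphi(y,y^*)=0\text{ for all }y\in F\}.$$ Let $\pi:\mathbb{R}^{q+1}\to\mathbb{R}^q$, $\pi(w_1,\dots,w_{q+1})=(w_1,\dots,w_{q-1},w_{q+1})$, and for $F\subseteq\mathbb{R}^q$, $\bar F\subseteq\mathbb{R}^{q+1}$ put $$\Phi(F)=\pi^{-1}[F]\cap\{(w,t)\in\mathbb{R}^q\times\mathbb{R}\mid e^{\intercal}w=1\},\qquad \Phi^{-1}(\bar F)=\pi[\bar F].$$ A face of a polyhedral convex set $M$ is a convex subset $F\subseteq M$ such that $x,y\in M$, $\lambda\in(0,1)$ and $\lambda x+(1-\lambda)y\in F$ imply $x,y\in F$; it is proper if $\emptyset\ne F\ne M$. A point $x\in M\subseteq\mathbb{R}^k$ is $\mathbb{R}^k_+$-maximal if $(\{x\}+\mathbb{R}^k_+\setminus\{0\})\cap M=\emptyset$, and weakly $\mathbb{R}^k_+$-minimal if $(\{x\}-\operatorname{int}\mathbb{R}^k_+)\cap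 M=\emptyset$; a face of $M$ is called $\mathbb{R}^k_+$-maximal (weakly $\mathbb{R}^k_+$-minimal) if all of its points are. Then $\Psi\circ\Phi^{-1}$ is an inclusion-reversing (that is, $\bar F_1\subseteq\bar F_2$ implies $(\Psi\circ\Phi^{-1})(\bar F_2)\subseteq(\Psi\circ\Phi^{-1})(\bar F_1)$) bijection from the set of all $\mathbb{R}^{q+1}_+$-maximal proper faces of $\bar{\mathcal{D}}$ onto the set of all weakly $\mathbb{R}^q_+$-minimal proper faces of $\mathcal{P}$, and its inverse map is $\Phi\circ\Psi^{-1}$. Moreover, for every $\mathbb{R}^{q+1}_+$-maximal proper face $\bar F^*$ of $\bar{\mathcal{D}}$, $$\dim\bar F^*+\dim(\Psi\circ\Phi^{-1})(\bar F^*)=q-1.$$ -/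

import Mathlib

open scoped Pointwise

/-! ### Minimal points and faces -/

section General

variable {V : Type*} [AddCommGroup V]

/-- `x` is a `C`-minimal element of `M`. -/
def IsConeMinimal (C M : Set V) (x : V) : Prop :=
  x ∈ M ∧ ({x} - (C \ {0})) ∩ M = ∅

/-- `x` is a weakly `C`-minimal element of `M` (used for cones `C` with nonempty interior). -/
def IsWeaklyConeMinimal [TopologicalSpace V] (C M : Set V) (x : V) : Prop :=
  x ∈ M ∧ ({x} - interior C) ∩ M = ∅

/-- `x` is a `C`-maximal element of `M`, i.e. a `(-C)`-minimal one. -/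
def IsConeMaximal (C M : Set V) (x : V) : Prop :=
  IsConeMinimal (-C) M x

variable [Module ℝ V]

/-- `F` is a face of `M`: a convex subset of `M` such that every open segment with end points
in `M` that meets `F` has both end points in `F`. -/
def IsFace (M F : Set V) : Prop :=
  Convex ℝ F ∧ IsExtreme ℝ M F

/-- `F` is a proper face of `M`. -/
def IsProperFace (M F : Set V) : Prop :=
  IsFace M F ∧ F.Nonempty ∧ F ≠ M

/-- The dimension of a (nonempty) convex set, i.e. the dimension of its affine hull. -/
noncomputable def setDim (F : Set V) : ℕ :=
  Module.finrank ℝ (vectorSpan ℝ F)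

/-- The `C`-maximal proper faces of `M`. -/
def maximalProperFaces (C M : Set V) : Set (Set V) :=
  {F | IsProperFace M F ∧ ∀ x ∈ F, IsConeMaximal C M x}

/-- The weakly `C`-minimal proper faces of `M`. -/
def weaklyMinimalProperFaces [TopologicalSpace V] (C M : Set V) : Set (Set V) :=
  {F | IsProperFace M F ∧ ∀ x ∈ F, IsWeaklyConeMinimal C M x}

end General

/-- The cone `ℝ^k_+`. -/
def nonnegOrthant (k : ℕ) : Set (Fin k → ℝ) :=
  {y | ∀ i, 0 ≤ y i}

/-! ### The linear programs

The number of objectives is `q = r + 1`, so that `ℝ^q` is `Fin (r + 1) → ℝ` with last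
coordinate `Fin.last r`, and `ℝ^(q+1)` is `Fin (r + 2) → ℝ`. -/

section Problems

variable {m n r : ℕ}

/-- The cone `K = {y ∈ ℝ^q | y_1 = ⋯ = y_(q-1) = 0, y_q ≥ 0}`. -/
def coneK (r : ℕ) : Set (Fin (r + 1) → ℝ) :=
  {y | (∀ i : Fin r, y i.castSucc = 0) ∧ 0 ≤ y (Fin.last r)}

/-- The feasible region `S = {x | A x ≥ b}`. -/
def primalFeasible (A : Matrix (Fin m) (Fin n) ℝ) (b : Fin m → ℝ) : Set (Fin n → ℝ) :=
  {x | ∀ j, b j ≤ (A.mulVec x) j}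

/-- The upper image `𝒫 = P[S] + ℝ^q_+`. -/
def upperImage (P : Matrix (Fin (r + 1)) (Fin n) ℝ) (A : Matrix (Fin m) (Fin n) ℝ)
    (b : Fin m → ℝ) : Set (Fin (r + 1) → ℝ) :=
  P.mulVec '' primalFeasible A b + nonnegOrthant (r + 1)

/-- The common feasible region `T` of both dual problems:
`Aᵀ u = Pᵀ w`, `(u, w) ≥ 0`, `eᵀ w = 1`. -/
def dualFeasible (P : Matrix (Fin (r + 1)) (Fin n) ℝ) (A : Matrix (Fin m) (Fin n) ℝ) :
    Set ((Fin m → ℝ) × (Fin (r + 1) → ℝ)) :=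
  {p | A.transpose.mulVec p.1 = P.transpose.mulVec p.2 ∧
    (∀ j, 0 ≤ p.1 j) ∧ (∀ i, 0 ≤ p.2 i) ∧ ∑ i, p.2 i = 1}

/-- The geometric dual objective `D(u, w) = (w_1, …, w_(q-1), bᵀ u)`. -/
def geomObjective (b : Fin m → ℝ) (p : (Fin m → ℝ) × (Fin (r + 1) → ℝ)) : Fin (r + 1) → ℝ :=
  Fin.snoc (α := fun _ => ℝ) (fun i : Fin r => p.2 i.castSucc) (b ⬝ᵥ p.1)

/-- The parametric dual objective `D̄(u, w) = (w_1, …, w_q, bᵀ u)`. -/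
def paramObjective (b : Fin m → ℝ) (p : (Fin m → ℝ) × (Fin (r + 1) → ℝ)) : Fin (r + 2) → ℝ :=
  Fin.snoc (α := fun _ => ℝ) p.2 (b ⬝ᵥ p.1)

/-- The lower image `𝒟 = D[T] - K` of the geometric dual problem. -/
def lowerImage (P : Matrix (Fin (r + 1)) (Fin n) ℝ) (A : Matrix (Fin m) (Fin n) ℝ)
    (b : Fin m → ℝ) : Set (Fin (r + 1) → ℝ) :=
  geomObjective b '' dualFeasible P A - coneK r

/-- The lower image `𝒟̄ = D̄[T] - ℝ^(q+1)_+` of the parametric dual problem. -/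
def paramLowerImage (P : Matrix (Fin (r + 1)) (Fin n) ℝ) (A : Matrix (Fin m) (Fin n) ℝ)
    (b : Fin m → ℝ) : Set (Fin (r + 2) → ℝ) :=
  paramObjective b '' dualFeasible P A - nonnegOrthant (r + 2)

/-! ### The duality maps -/

/-- The coupling function
`φ(y, y*) = ∑_{i<q} y_i y*_i + y_q (1 - ∑_{i<q} y*_i) - y*_q`. -/
def coupling (y ys : Fin (r + 1) → ℝ) : ℝ :=
  ∑ i : Fin r, y i.castSucc * ys i.castSucc
    + y (Fin.last r) * (1 - ∑ i : Fin r, ys i.castSucc) - ys (Fin.last r)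

/-- `H(y*) = {y | φ(y, y*) = 0}`. -/
def primalHyperplane (ys : Fin (r + 1) → ℝ) : Set (Fin (r + 1) → ℝ) :=
  {y | coupling y ys = 0}

/-- `H*(y) = {y* | φ(y, y*) = 0}`. -/
def dualHyperplane (y : Fin (r + 1) → ℝ) : Set (Fin (r + 1) → ℝ) :=
  {ys | coupling y ys = 0}

/-- `Ψ(F*) = ⋂_{y* ∈ F*} H(y*) ∩ 𝒫`. -/
def Psi (P : Matrix (Fin (r + 1)) (Fin n) ℝ) (A : Matrix (Fin m) (Fin n) ℝ)
    (b : Fin m → ℝ) (Fs : Set (Fin (r + 1) → ℝ)) : Set (Fin (r + 1) → ℝ) :=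
  (⋂ ys ∈ Fs, primalHyperplane ys) ∩ upperImage P A b

/-- `Ψ⁻¹(F) = ⋂_{y ∈ F} H*(y) ∩ 𝒟`. -/
def PsiInv (P : Matrix (Fin (r + 1)) (Fin n) ℝ) (A : Matrix (Fin m) (Fin n) ℝ)
    (b : Fin m → ℝ) (F : Set (Fin (r + 1) → ℝ)) : Set (Fin (r + 1) → ℝ) :=
  (⋂ y ∈ F, dualHyperplane y) ∩ lowerImage P A b

/-- The projection `π(w_1, …, w_(q+1)) = (w_1, …, w_(q-1), w_(q+1))`. -/
def proj (w : Fin (r + 2) → ℝ) : Fin (r + 1) → ℝ :=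
  Fin.snoc (α := fun _ => ℝ) (fun i : Fin r => w i.castSucc.castSucc) (w (Fin.last (r + 1)))

/-- `Φ(F) = π⁻¹[F] ∩ {(w, t) ∈ ℝ^q × ℝ | eᵀ w = 1}`. -/
def Phi (F : Set (Fin (r + 1) → ℝ)) : Set (Fin (r + 2) → ℝ) :=
  proj ⁻¹' F ∩ {v | ∑ i : Fin (r + 1), v i.castSucc = 1}

/-- `Φ⁻¹(F̄) = π[F̄]`. -/
def PhiInv (Fb : Set (Fin (r + 2) → ℝ)) : Set (Fin (r + 1) → ℝ) :=
  proj '' Fb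

end Problems

/-! Write $(w,t)$ for the points of $\mathbb{R}^{q+1}$. Everything reduces to polarity for one
pairing, $\langle y,(w,t)\rangle=w^{\intercal}y-t$, between $\mathcal{P}$ and the slice of
$\bar{\mathcal{D}}$ on $e^{\intercal}w=1$. On that hyperplane the coordinate dropped by $\pi$ can be
recovered, $\pi$ matches the slice with $\mathcal{D}$, and $\varphi$ becomes the pairing; so
$\Psi\circ\Phi^{-1}$ and $\Phi\circ\Psi^{-1}$ are the two polar maps. The maximal proper faces of
$\bar{\mathcal{D}}$ are the nonempty faces of the slice on which $t$ cannot be increased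
(`mem_maximalProperFaces_iff`).

Weak duality makes the pairing nonnegative, so polars are faces and inclusions reverse. The
substance is that the double polar of a face is the face itself. By Fourier–Motzkin elimination,
each of the two polyhedra is cut out by finitely many inequalities whose coefficients are, up to
homogenization, points of the other one. At a point of the face where as few of them as possible are
active, one can move a little, both ways, towards any common zero of the polar face without leaving
the polyhedron (`exists_core_upperImage`, `exists_core_paramSlice`); extremality then puts points of
the double polar into the face.

The same local description identifies the direction of a face $G$ of $\mathcal{P}$ with the
orthogonal complement of the weights $w$ of its polar face. These span a space of dimension one more
than that of the polar face, whence the dimension formula. -/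

/-! ### Elimination of variables from a system of linear inequalities -/

section Elimination

open Matrix

/-- Elimination of a single variable `a` from the system `0 ≤ c i + a * v i`: its solvability is
equivalent to finitely many nonnegative combinations of the entries of `c` being nonnegative. -/
theorem exists_elimination_single {I : Type} [Fintype I] (v : I → ℝ) :
    ∃ (K : Type) (_ : Fintype K) (L : Matrix K I ℝ), (∀ k i, 0 ≤ L k i) ∧ L *ᵥ v = 0 ∧
      ∀ c : I → ℝ, (∀ k, 0 ≤ (L *ᵥ c) k) → ∃ a : ℝ, ∀ i, 0 ≤ c i + a * v i := by
  classical
  -- Rows `.inl i` keep the inequalities free of `a`; rows `.inr (p, q)` combine a lower with an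
  -- upper bound on `a` so that `a` cancels. All remaining indices carry a zero row.
  let L : Matrix (I ⊕ I × I) I ℝ := fun k => match k with
    | .inl i => if v i = 0 then Pi.single i 1 else 0
    | .inr (p, q) => if 0 < v p ∧ v q < 0 then Pi.single q (v p) + Pi.single p (-v q) else 0
  have hL₁ (c : I → ℝ) (i : I) (hi : v i = 0) : (L *ᵥ c) (.inl i) = c i := by
    simp [L, mulVec, hi]
  have hL₂ (c : I → ℝ) (p q : I) (hp : 0 < v p) (hq : v q < 0) :
      (L *ᵥ c) (.inr (p, q)) = v p * c q - v q * c p := by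
    have hrow : L (.inr (p, q)) = Pi.single q (v p) + Pi.single p (-v q) := if_pos ⟨hp, hq⟩
    rw [mulVec, hrow, add_dotProduct, single_dotProduct, single_dotProduct]
    ring
  refine ⟨I ⊕ I × I, inferInstance, L, ?_, ?_, ?_⟩
  · rintro (i | ⟨p, q⟩) j
    · by_cases hi : v i = 0
      · simp only [L, hi, if_true, Pi.single_apply]
        split_ifs <;> norm_num
      · simp [L, hi]
    · by_cases h : 0 < v p ∧ v q < 0
      · simp only [L, h, and_self, if_true, Pi.add_apply, Pi.single_apply]
        have h₁ := h.1.le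
        have h₂ := h.2.le
        split_ifs <;> linarith
      · simp [L, h]
  · funext k
    rcases k with i | ⟨p, q⟩
    · by_cases hi : v i = 0
      · simp [hL₁ v i hi, hi]
      · simp [L, mulVec, hi]
    · by_cases h : 0 < v p ∧ v q < 0
      · rw [hL₂ v p q h.1 h.2, Pi.zero_apply]
        ring
      · simp [L, mulVec, h]
  · intro c hc
    -- The pair rows say that every lower bound on `a` is at most every upper bound, so the largest
    -- lower bound works. If there is none, any number below all quotients does; the junk quotients
    -- with `v q = 0` are harmless.
    have key : ∃ a : ℝ, (∀ p, 0 < v p → -c p / v p ≤ a) ∧ ∀ q, v q < 0 → a ≤ -c q / v q := by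
      by_cases hpos : ∃ p, 0 < v p
      · obtain ⟨p₀, hp₀⟩ := hpos
        refine ⟨sSup ((fun p => -c p / v p) '' {p | 0 < v p}), fun p hp => ?_, fun q hq => ?_⟩
        · exact le_csSup ((Set.toFinite _).image _).bddAbove ⟨p, hp, rfl⟩
        · refine csSup_le ⟨_, p₀, hp₀, rfl⟩ ?_
          rintro _ ⟨p, hp, rfl⟩
          have h := hc (.inr (p, q))
          rw [hL₂ c p q hp hq] at h
          change 0 < v p at hp
          show -c p / v p ≤ -c q / v q
          rw [div_le_iff₀ hp, div_mul_eq_mul_div, le_div_iff_of_neg hq]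
          linarith
      · obtain ⟨a, ha⟩ := (Set.finite_range fun q => -c q / v q).bddBelow
        exact ⟨a, fun p hp => absurd ⟨p, hp⟩ hpos, fun q _ => ha ⟨q, rfl⟩⟩
    obtain ⟨a, ha₁, ha₂⟩ := key
    refine ⟨a, fun i => ?_⟩
    rcases lt_trichotomy (v i) 0 with hi | hi | hi
    · have h := ha₂ i hi
      rw [le_div_iff_of_neg hi] at h
      linarith
    · have h := hc (.inl i)
      rw [hL₁ c i hi] at h
      simpa [hi] using h
    · have h := ha₁ i hi
      rw [div_le_iff₀ hi] at h
      linarith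

/-- Fourier–Motzkin elimination: solvability of `0 ≤ c + B x` is equivalent to the nonnegativity
of finitely many nonnegative combinations of the entries of `c` annihilating `B`. -/
theorem exists_elimination {n : ℕ} : ∀ {I : Type} [Fintype I] (B : Matrix I (Fin n) ℝ),
    ∃ (K : Type) (_ : Fintype K) (L : Matrix K I ℝ), (∀ k i, 0 ≤ L k i) ∧ L * B = 0 ∧
      ∀ c : I → ℝ, (∀ k, 0 ≤ (L *ᵥ c) k) → ∃ x : Fin n → ℝ, ∀ i, 0 ≤ c i + (B *ᵥ x) i := by
  induction n with
  | zero =>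
    intro I _ B
    classical
    refine ⟨I, inferInstance, 1, fun k i => ?_, Subsingleton.elim _ _, fun c hc => ⟨0, ?_⟩⟩
    · rw [one_apply]
      split_ifs <;> norm_num
    · simpa using hc
  | succ n ih =>
    intro I _ B
    obtain ⟨K₁, _, L₁, hL₁, hB₁, hc₁⟩ := exists_elimination_single fun i => B i 0
    obtain ⟨K₂, _, L₂, hL₂, hB₂, hc₂⟩ := ih (L₁ * B.submatrix id Fin.succ)
    have hB (x : Fin (n + 1) → ℝ) (i : I) :
        (B *ᵥ x) i = x 0 * B i 0 + (B.submatrix id Fin.succ *ᵥ Fin.tail x) i := by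
      simp [mulVec, dotProduct, Fin.sum_univ_succ, Fin.tail, mul_comm]
    refine ⟨K₂, inferInstance, L₂ * L₁, fun k i => ?_, ?_, fun c hc => ?_⟩
    · exact Finset.sum_nonneg fun j _ => mul_nonneg (hL₂ k j) (hL₁ j i)
    · ext k j
      refine Fin.cases ?_ (fun j => ?_) j
      · have : (L₂ * L₁ * B) k 0 = (L₂ *ᵥ (L₁ *ᵥ fun i => B i 0)) k := by
          rw [mulVec_mulVec]
          rfl
        rw [this, hB₁, mulVec_zero]
        rfl
      · rw [Matrix.mul_assoc]
        exact congrFun (congrFun hB₂ k) j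
    -- Back-substitution: `x'` solves the system from which the first variable has been eliminated,
    -- which is the condition for a value `a` of that variable to exist.
    · obtain ⟨x', hx'⟩ := hc₂ (L₁ *ᵥ c) (by simpa [mulVec_mulVec] using hc)
      obtain ⟨a, ha⟩ := hc₁ (c + B.submatrix id Fin.succ *ᵥ x') fun k => by
        simpa [mulVec_add, mulVec_mulVec] using hx' k
      refine ⟨Fin.cons a x', fun i => ?_⟩
      have h := ha i
      rw [hB]
      simp only [Pi.add_apply] at h
      simp only [Fin.cons_zero, Fin.tail_cons]
      linarith

end Elimination

/-! ### Faces of polyhedra -/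

section Faces

variable {V : Type*} [AddCommGroup V] [Module ℝ V] {ι : Type*} [Finite ι]

/-- A convex set on which finitely many affine functions are nonnegative contains a point at which
as few of them as possible vanish. -/
theorem exists_mem_forall_eq_zero_imp {F : Set V} (hF : Convex ℝ F) (hne : F.Nonempty)
    (g : ι → V →ᵃ[ℝ] ℝ) (hg : ∀ i, ∀ x ∈ F, 0 ≤ g i x) :
    ∃ x₀ ∈ F, ∀ i, g i x₀ = 0 → ∀ x ∈ F, g i x = 0 := by
  classical
  cases nonempty_fintype ι
  suffices h : ∀ s : Finset ι, ∃ x₀ ∈ F, ∀ i ∈ s, g i x₀ = 0 → ∀ x ∈ F, g i x = 0 by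
    obtain ⟨x₀, hx₀, h⟩ := h Finset.univ
    exact ⟨x₀, hx₀, fun i => h i (Finset.mem_univ i)⟩
  intro s
  induction s using Finset.induction_on with
  | empty => exact ⟨hne.some, hne.some_mem, by simp⟩
  | insert j s _ ih =>
    obtain ⟨x₀, hx₀, h₀⟩ := ih
    by_cases hj : ∀ x ∈ F, g j x = 0
    · refine ⟨x₀, hx₀, fun i hi => ?_⟩
      rcases Finset.mem_insert.1 hi with rfl | hi
      · exact fun _ => hj
      · exact h₀ i hi
    · push Not at hj
      obtain ⟨x₁, hx₁, hj⟩ := hj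
      -- Nonnegative values average to zero only if both are zero, so at the midpoint no new
      -- function vanishes, and `g j` does not.
      have hmid (i : ι) : g i (AffineMap.lineMap x₀ x₁ (1 / 2 : ℝ)) = (g i x₀ + g i x₁) / 2 := by
        rw [AffineMap.apply_lineMap, AffineMap.lineMap_apply_ring']
        ring
      refine ⟨AffineMap.lineMap x₀ x₁ (1 / 2 : ℝ),
        hF.lineMap_mem hx₀ hx₁ ⟨by norm_num, by norm_num⟩, fun i hi h => ?_⟩
      rw [hmid] at h
      have h₁ := hg i x₀ hx₀
      have h₂ := hg i x₁ hx₁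
      rcases Finset.mem_insert.1 hi with rfl | hi
      · exact absurd (by linarith) hj
      · exact h₀ i hi (by linarith)

/-- If the inequalities `0 ≤ g i` hold at `x₀` and those active at `x₀` are active at `x`, then
they hold on the line through `x₀` and `x` near `x₀`. -/
theorem exists_pos_forall_lineMap_nonneg (g : ι → V →ᵃ[ℝ] ℝ) {x₀ x : V}
    (h₀ : ∀ i, 0 ≤ g i x₀) (h : ∀ i, g i x₀ = 0 → g i x = 0) :
    ∃ ε > 0, ∀ c : ℝ, |c| ≤ ε → ∀ i, 0 ≤ g i (AffineMap.lineMap x₀ x c) := by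
  have hev : ∀ᶠ c : ℝ in nhds 0, ∀ i, 0 ≤ g i (AffineMap.lineMap x₀ x c) := by
    rw [Filter.eventually_all]
    intro i
    simp only [AffineMap.apply_lineMap, AffineMap.lineMap_apply_ring']
    rcases (h₀ i).eq_or_lt with h₁ | h₁
    · simp [h i h₁.symm, ← h₁]
    · have hc : Filter.Tendsto (fun c : ℝ => c * (g i x - g i x₀) + g i x₀) (nhds 0)
          (nhds (0 * (g i x - g i x₀) + g i x₀)) := by
        apply Continuous.tendsto
        fun_prop
      rw [zero_mul, zero_add] at hc
      exact (hc.eventually (lt_mem_nhds h₁)).mono fun _ => le_of_lt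
  obtain ⟨ε, hε, h⟩ := Metric.eventually_nhds_iff.1 hev
  refine ⟨ε / 2, by positivity, fun c hc => h ?_⟩
  rw [Real.dist_eq, sub_zero]
  linarith

/-- A point of `M` that can be reflected (with contraction) in a point of a face of `M`
without leaving `M` belongs to that face. -/
theorem IsExtreme.mem_of_lineMap_neg_mem {M F : Set V} (hF : IsExtreme ℝ M F) {x₀ x : V}
    (hx₀ : x₀ ∈ F) (hx : x ∈ M) {ε : ℝ} (hε : 0 < ε) (hz : AffineMap.lineMap x₀ x (-ε) ∈ M) :
    x ∈ F := by
  -- With $z=x_0-\varepsilon(x-x_0)$ one has $x_0=(\varepsilon x+z)/(1+\varepsilon)$.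
  refine hF.left_mem_of_mem_openSegment hx hz hx₀
    ⟨ε / (1 + ε), 1 / (1 + ε), by positivity, by positivity, by field_simp; ring, ?_⟩
  have h1 : (1 + ε) ≠ 0 := by positivity
  rw [AffineMap.lineMap_apply_module]
  match_scalars
  · field_simp
    ring
  · field_simp
    ring

/-- A point of a face of `M` along which a segment can be prolonged in both directions within `M`
has the whole segment in that face. -/
theorem IsExtreme.lineMap_mem_of_forall_abs_le {M F : Set V} (hF : IsExtreme ℝ M F) {x₀ x : V}
    (hx₀ : x₀ ∈ F) {ε : ℝ} (hε : 0 < ε)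
    (h : ∀ c : ℝ, |c| ≤ ε → AffineMap.lineMap x₀ x c ∈ M) : AffineMap.lineMap x₀ x ε ∈ F := by
  refine hF.left_mem_of_mem_openSegment (h ε (abs_of_pos hε).le)
    (h (-ε) (by rw [abs_neg, abs_of_pos hε])) hx₀ ⟨1 / 2, 1 / 2, by norm_num, by norm_num, by norm_num, ?_⟩
  simp only [AffineMap.lineMap_apply_module]
  module

/-- The zeros in `M` of a family of affine functions that are nonnegative on `M` form a face. -/
theorem isFace_setOf_forall_eq_zero {κ : Type*} {M : Set V} (hM : Convex ℝ M) (J : Set κ)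
    (f : κ → V →ᵃ[ℝ] ℝ) (hf : ∀ j ∈ J, ∀ x ∈ M, 0 ≤ f j x) :
    IsFace M {x | x ∈ M ∧ ∀ j ∈ J, f j x = 0} := by
  refine ⟨fun x hx y hy a b ha hb hab => ⟨hM hx.1 hy.1 ha hb hab, fun j hj => ?_⟩,
    fun x hx => hx.1, ?_⟩
  · rw [Convex.combo_affine_apply hab, hx.2 j hj, hy.2 j hj]
    simp
  · rintro x hx y hy z hz ⟨a, b, ha, hb, hab, rfl⟩
    refine ⟨hx, fun j hj => ?_⟩
    have h := hz.2 j hj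
    rw [Convex.combo_affine_apply hab, smul_eq_mul, smul_eq_mul] at h
    have h₁ := mul_nonneg hb.le (hf j hj y hy)
    have h₂ := hf j hj x hx
    nlinarith

end Faces

/-! ### Dimensions -/

section Dimension

/-- The affine hull of `X` misses the origin, so the span is the direct sum of its direction and the
line through one point of `X`. -/
theorem finrank_span_eq_finrank_vectorSpan_add_one {V : Type*} [AddCommGroup V] [Module ℝ V]
    [FiniteDimensional ℝ V] (f : V →ₗ[ℝ] ℝ) {X : Set V} (hne : X.Nonempty)
    (hf : ∀ x ∈ X, f x = 1) :
    Module.finrank ℝ (Submodule.span ℝ X) = Module.finrank ℝ (vectorSpan ℝ X) + 1 := by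
  obtain ⟨x₀, hx₀⟩ := hne
  have hker : vectorSpan ℝ X ≤ LinearMap.ker f := by
    rw [vectorSpan, Submodule.span_le]
    rintro _ ⟨x, hx, y, hy, rfl⟩
    simp [hf x hx, hf y hy]
  have hsup : Submodule.span ℝ X = vectorSpan ℝ X ⊔ Submodule.span ℝ {x₀} := by
    apply le_antisymm
    · rw [Submodule.span_le]
      intro x hx
      rw [← sub_add_cancel x x₀]
      exact Submodule.add_mem_sup (vsub_mem_vectorSpan ℝ hx hx₀) (Submodule.mem_span_singleton_self x₀)
    · refine sup_le ?_ (Submodule.span_mono (by simpa using hx₀))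
      rw [vectorSpan, Submodule.span_le]
      rintro _ ⟨x, hx, y, hy, rfl⟩
      exact Submodule.sub_mem _ (Submodule.subset_span hx) (Submodule.subset_span hy)
  have hinf : vectorSpan ℝ X ⊓ Submodule.span ℝ {x₀} = ⊥ := by
    rw [eq_bot_iff]
    rintro z ⟨hz₁, hz₂⟩
    obtain ⟨c, rfl⟩ := Submodule.mem_span_singleton.1 hz₂
    have : c = 0 := by simpa [hf x₀ hx₀] using hker hz₁
    simp [this]
  have hx₀' : x₀ ≠ 0 := by
    rintro rfl
    simpa using hf 0 hx₀
  have h := Submodule.finrank_sup_add_finrank_inf_eq (vectorSpan ℝ X) (Submodule.span ℝ {x₀})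
  rw [hinf, finrank_bot, finrank_span_singleton hx₀', ← hsup] at h
  exact h

theorem finrank_add_finrank_eq_card_of_mem_iff_dotProduct {κ : Type*} [Fintype κ]
    {W U : Submodule ℝ (κ → ℝ)} (h : ∀ d, d ∈ U ↔ ∀ w ∈ W, w ⬝ᵥ d = 0) :
    Module.finrank ℝ W + Module.finrank ℝ U = Fintype.card κ := by
  classical
  have hU : U = (W.map (dotProductEquiv ℝ κ).toLinearMap).dualCoannihilator := by
    ext d
    rw [h, Submodule.mem_dualCoannihilator]
    constructor
    · rintro hd _ ⟨w, hw, rfl⟩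
      exact hd w hw
    · exact fun hd w hw => hd _ (Submodule.mem_map_of_mem hw)
  have h' := Subspace.finrank_add_finrank_dualCoannihilator_eq
    (W.map (dotProductEquiv ℝ κ).toLinearMap)
  rw [← hU, Module.finrank_fintype_fun_eq_card] at h'
  rw [← h', LinearEquiv.finrank_map_eq (dotProductEquiv ℝ κ) W]

end Dimension
/-! ### The slice of the parametric lower image and its pairing with the upper image -/

section Slice

open Matrix

variable {m n r : ℕ}

/-- The projection `(w, t) ↦ w`. -/
def weight (r : ℕ) : (Fin (r + 2) → ℝ) →ₗ[ℝ] Fin (r + 1) → ℝ :=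
  LinearMap.funLeft ℝ ℝ Fin.castSucc

@[simp]
theorem weight_apply (v : Fin (r + 2) → ℝ) (i : Fin (r + 1)) : weight r v i = v i.castSucc := rfl

/-- The affine function `y ↦ wᵀ y - c`. -/
noncomputable def dotSub (w : Fin (r + 1) → ℝ) (c : ℝ) : (Fin (r + 1) → ℝ) →ᵃ[ℝ] ℝ :=
  (dotProductEquiv ℝ (Fin (r + 1)) w).toAffineMap - AffineMap.const ℝ _ c

@[simp]
theorem dotSub_apply (w y : Fin (r + 1) → ℝ) (c : ℝ) : dotSub w c y = w ⬝ᵥ y - c := rfl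

/-- The linear function `(w, t) ↦ wᵀ y - s t`. -/
noncomputable def homPairing (y : Fin (r + 1) → ℝ) (s : ℝ) : (Fin (r + 2) → ℝ) →ₗ[ℝ] ℝ :=
  (dotProductEquiv ℝ (Fin (r + 1)) y) ∘ₗ weight r - s • LinearMap.proj (Fin.last (r + 1))

theorem homPairing_apply (y : Fin (r + 1) → ℝ) (s : ℝ) (v : Fin (r + 2) → ℝ) :
    homPairing y s v = weight r v ⬝ᵥ y - s * v (Fin.last (r + 1)) := by
  rw [dotProduct_comm]
  rfl

/-- The pairing `⟨y, (w, t)⟩ = wᵀ y - t`, which is linear in `(w, t)`. -/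
noncomputable def pairing (y : Fin (r + 1) → ℝ) : (Fin (r + 2) → ℝ) →ₗ[ℝ] ℝ := homPairing y 1

theorem pairing_apply (y : Fin (r + 1) → ℝ) (v : Fin (r + 2) → ℝ) :
    pairing y v = weight r v ⬝ᵥ y - v (Fin.last (r + 1)) := by
  rw [pairing, homPairing_apply, one_mul]

/-- The points `(w, t)` of the parametric lower image with `eᵀ w = 1`. -/
def paramSlice (P : Matrix (Fin (r + 1)) (Fin n) ℝ) (A : Matrix (Fin m) (Fin n) ℝ)
    (b : Fin m → ℝ) : Set (Fin (r + 2) → ℝ) :=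
  {v | ∑ i, weight r v i = 1 ∧ (∀ i, 0 ≤ weight r v i) ∧
    ∃ u : Fin m → ℝ, Aᵀ *ᵥ u = Pᵀ *ᵥ weight r v ∧ (∀ j, 0 ≤ u j) ∧ v (Fin.last (r + 1)) ≤ b ⬝ᵥ u}

/-- The pairs `(y, s)` with `s ≥ 0` such that `s b ≤ A x` and `P x ≤ y` for some `x`. -/
def homUpperImage (P : Matrix (Fin (r + 1)) (Fin n) ℝ) (A : Matrix (Fin m) (Fin n) ℝ)
    (b : Fin m → ℝ) : Set ((Fin (r + 1) → ℝ) × ℝ) :=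
  {p | 0 ≤ p.2 ∧ ∃ x : Fin n → ℝ, (∀ j, p.2 * b j ≤ (A *ᵥ x) j) ∧ ∀ i, (P *ᵥ x) i ≤ p.1 i}

variable {P : Matrix (Fin (r + 1)) (Fin n) ℝ} {A : Matrix (Fin m) (Fin n) ℝ} {b : Fin m → ℝ}

theorem mem_upperImage_iff {y : Fin (r + 1) → ℝ} :
    y ∈ upperImage P A b ↔ ∃ x : Fin n → ℝ, (∀ j, b j ≤ (A *ᵥ x) j) ∧ ∀ i, (P *ᵥ x) i ≤ y i := by
  constructor
  · rintro ⟨_, ⟨x, hx, rfl⟩, c, hc, rfl⟩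
    exact ⟨x, hx, fun i => le_add_of_nonneg_right (hc i)⟩
  · rintro ⟨x, hx, h⟩
    exact ⟨_, ⟨x, hx, rfl⟩, y - P *ᵥ x, fun i => sub_nonneg.2 (h i), add_sub_cancel _ _⟩

theorem mem_upperImage_iff_mk_one_mem {y : Fin (r + 1) → ℝ} :
    y ∈ upperImage P A b ↔ (y, (1 : ℝ)) ∈ homUpperImage P A b := by
  simp [mem_upperImage_iff, homUpperImage]

theorem add_mem_homUpperImage {p p' : (Fin (r + 1) → ℝ) × ℝ} (hp : p ∈ homUpperImage P A b)
    (hp' : p' ∈ homUpperImage P A b) : p + p' ∈ homUpperImage P A b := by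
  obtain ⟨hs, x, hx, hy⟩ := hp
  obtain ⟨hs', x', hx', hy'⟩ := hp'
  refine ⟨add_nonneg hs hs', x + x', fun j => ?_, fun i => ?_⟩
  · rw [mulVec_add, Prod.snd_add, add_mul]
    exact add_le_add (hx j) (hx' j)
  · rw [mulVec_add]
    exact add_le_add (hy i) (hy' i)

theorem smul_mem_homUpperImage {p : (Fin (r + 1) → ℝ) × ℝ} (hp : p ∈ homUpperImage P A b)
    {c : ℝ} (hc : 0 ≤ c) : c • p ∈ homUpperImage P A b := by
  obtain ⟨hs, x, hx, hy⟩ := hp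
  refine ⟨mul_nonneg hc hs, c • x, fun j => ?_, fun i => ?_⟩
  · rw [mulVec_smul, Prod.smul_snd, smul_eq_mul, mul_assoc]
    exact mul_le_mul_of_nonneg_left (hx j) hc
  · rw [mulVec_smul]
    exact mul_le_mul_of_nonneg_left (hy i) hc

theorem inv_smul_mem_upperImage {y : Fin (r + 1) → ℝ} {s : ℝ} (h : (y, s) ∈ homUpperImage P A b)
    (hs : 0 < s) : s⁻¹ • y ∈ upperImage P A b := by
  have h' := smul_mem_homUpperImage h (inv_nonneg.2 hs.le)
  rw [mem_upperImage_iff_mk_one_mem]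
  simpa [hs.ne'] using h'

theorem convex_upperImage : Convex ℝ (upperImage P A b) := by
  intro y hy z hz c d hc hd hcd
  rw [mem_upperImage_iff_mk_one_mem] at hy hz ⊢
  have h := add_mem_homUpperImage (smul_mem_homUpperImage hy hc) (smul_mem_homUpperImage hz hd)
  simpa [hcd] using h

theorem add_mem_upperImage {y c : Fin (r + 1) → ℝ} (hy : y ∈ upperImage P A b)
    (hc : ∀ i, 0 ≤ c i) : y + c ∈ upperImage P A b := by
  rw [mem_upperImage_iff] at hy ⊢
  obtain ⟨x, hx, h⟩ := hy
  exact ⟨x, hx, fun i => (h i).trans (le_add_of_nonneg_right (hc i))⟩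

theorem convex_paramSlice : Convex ℝ (paramSlice P A b) := by
  rintro v ⟨hv₁, hv₂, u, hu₁, hu₂, hu₃⟩ v' ⟨hv₁', hv₂', u', hu₁', hu₂', hu₃'⟩ c d hc hd hcd
  refine ⟨?_, fun i => ?_, c • u + d • u', ?_, fun j => ?_, ?_⟩
  · simp only [map_add, map_smul, Pi.add_apply, Pi.smul_apply, smul_eq_mul,
      Finset.sum_add_distrib, ← Finset.mul_sum, hv₁, hv₁']
    linarith
  · simp only [map_add, map_smul, Pi.add_apply, Pi.smul_apply, smul_eq_mul]
    exact add_nonneg (mul_nonneg hc (hv₂ i)) (mul_nonneg hd (hv₂' i))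
  · simp only [map_add, map_smul, mulVec_add, mulVec_smul, hu₁, hu₁']
  · exact add_nonneg (mul_nonneg hc (hu₂ j)) (mul_nonneg hd (hu₂' j))
  · simp only [dotProduct_add, dotProduct_smul, Pi.add_apply, Pi.smul_apply, smul_eq_mul]
    exact add_le_add (mul_le_mul_of_nonneg_left hu₃ hc) (mul_le_mul_of_nonneg_left hu₃' hd)

/-- Weak duality, in homogenized form. -/
theorem homPairing_nonneg {y : Fin (r + 1) → ℝ} {s : ℝ} (hy : (y, s) ∈ homUpperImage P A b)
    {v : Fin (r + 2) → ℝ} (hv : v ∈ paramSlice P A b) : 0 ≤ homPairing y s v := by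
  obtain ⟨hs, x, hx, hxy⟩ := hy
  obtain ⟨-, hw, u, hu₁, hu₂, hu₃⟩ := hv
  rw [homPairing_apply]
  have h₁ : weight r v ⬝ᵥ (P *ᵥ x) ≤ weight r v ⬝ᵥ y := dotProduct_le_dotProduct_of_nonneg_left hxy hw
  have h₂ : u ⬝ᵥ (s • b) ≤ u ⬝ᵥ (A *ᵥ x) := dotProduct_le_dotProduct_of_nonneg_left hx hu₂
  have h₃ : weight r v ⬝ᵥ (P *ᵥ x) = u ⬝ᵥ (A *ᵥ x) := by
    rw [dotProduct_mulVec, dotProduct_mulVec, ← mulVec_transpose, ← mulVec_transpose, hu₁]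
  have h₄ := mul_le_mul_of_nonneg_left hu₃ hs
  rw [dotProduct_smul, smul_eq_mul, dotProduct_comm u b] at h₂
  linarith

theorem pairing_nonneg {y : Fin (r + 1) → ℝ} (hy : y ∈ upperImage P A b)
    {v : Fin (r + 2) → ℝ} (hv : v ∈ paramSlice P A b) : 0 ≤ pairing y v :=
  homPairing_nonneg (mem_upperImage_iff_mk_one_mem.1 hy) hv

variable (P A b)

/-- The upper image is described by finitely many inequalities coming from the dual problem. -/
theorem exists_inequalities_upperImage :
    ∃ (K : Type) (_ : Fintype K) (u : K → Fin m → ℝ) (w : K → Fin (r + 1) → ℝ),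
      (∀ k, Aᵀ *ᵥ u k = Pᵀ *ᵥ w k ∧ (∀ j, 0 ≤ u k j) ∧ ∀ i, 0 ≤ w k i) ∧
      ∀ y, (∀ k, 0 ≤ w k ⬝ᵥ y - b ⬝ᵥ u k) → y ∈ upperImage P A b := by
  -- Membership of `y` is solvability of $0\le(-b,y)+(A,-P)x$. A row $(u,w)$ annihilates the matrix
  -- exactly when $A^{\intercal}u=P^{\intercal}w$.
  obtain ⟨K, hK, L, hL, hB, h⟩ := exists_elimination (fromRows A (-P))
  refine ⟨K, hK, fun k j => L k (.inl j), fun k i => L k (.inr i),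
    fun k => ⟨?_, fun j => hL _ _, fun i => hL _ _⟩, fun y hy => ?_⟩
  · funext l
    have h := congrFun (congrFun hB k) l
    simp only [mul_apply, Fintype.sum_sum_type, fromRows_apply_inl, fromRows_apply_inr,
      Matrix.neg_apply, mul_neg, Finset.sum_neg_distrib, Matrix.zero_apply] at h
    simp only [mulVec, dotProduct, transpose_apply]
    simp only [mul_comm] at h ⊢
    linarith
  · obtain ⟨x, hx⟩ := h (Sum.elim (-b) y) fun k => by
      have h := hy k
      rw [dotProduct_comm b] at h
      simp only [mulVec, dotProduct, Fintype.sum_sum_type, Sum.elim_inl, Sum.elim_inr,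
        Pi.neg_apply, mul_neg, Finset.sum_neg_distrib] at h ⊢
      linarith
    refine mem_upperImage_iff.2 ⟨x, fun j => ?_, fun i => ?_⟩
    · have h := hx (.inl j)
      simp only [fromRows_mulVec, Sum.elim_inl, Pi.neg_apply] at h
      linarith
    · have h := hx (.inr i)
      simp only [fromRows_mulVec, Sum.elim_inr, neg_mulVec, Pi.neg_apply] at h
      linarith

/-- The slice is described by finitely many inequalities coming from the primal problem. -/
theorem exists_inequalities_paramSlice :
    ∃ (K : Type) (_ : Fintype K) (c : K → Fin (r + 1) → ℝ) (s : K → ℝ),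
      (∀ k, (c k, s k) ∈ homUpperImage P A b) ∧
      ∀ v, ∑ i, weight r v i = 1 → (∀ k, 0 ≤ homPairing (c k) (s k) v) → v ∈ paramSlice P A b := by
  classical
  -- Here $u$ is eliminated from $u\ge0$, $b^{\intercal}u\ge t$ and $A^{\intercal}u=P^{\intercal}w$,
  -- the equation being split into two inequalities. The difference of their multipliers is the
  -- primal vector `x k`, and the multiplier of $b^{\intercal}u\ge t$ is $s$.
  obtain ⟨K, hK, L, hL, hB, h⟩ := exists_elimination
    (fromRows (fromRows (1 : Matrix (Fin m) (Fin m) ℝ) (of fun (_ : Unit) => b)) (fromRows Aᵀ (-Aᵀ)))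
  let x : K → Fin n → ℝ := fun k l => L k (.inr (.inr l)) - L k (.inr (.inl l))
  have hx (k : K) (j : Fin m) :
      (A *ᵥ x k) j = L k (.inl (.inl j)) + L k (.inl (.inr ())) * b j := by
    have h := congrFun (congrFun hB k) j
    simp only [mul_apply, Fintype.sum_sum_type, fromRows_apply_inl, fromRows_apply_inr,
      Matrix.neg_apply, transpose_apply, mul_neg, Finset.sum_neg_distrib, Matrix.zero_apply, one_apply, of_apply,
      mul_ite, mul_one, mul_zero, Finset.sum_ite_eq', Finset.mem_univ, if_true,
      Finset.univ_unique, Finset.sum_singleton] at h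
    simp only [mulVec, dotProduct, x, mul_sub, Finset.sum_sub_distrib]
    simp only [mul_comm] at h ⊢
    linarith
  -- The additional pairs $(e_i,0)$ encode $w\ge0$.
  refine ⟨Fin (r + 1) ⊕ K, inferInstance, Sum.elim (fun i => Pi.single i 1) fun k => P *ᵥ x k,
    Sum.elim 0 fun k => L k (.inl (.inr ())), ?_, fun v hv₁ hv => ?_⟩
  · rintro (i | k)
    · refine ⟨le_rfl, 0, fun j => by simp, fun j => ?_⟩
      simp only [mulVec_zero, Pi.zero_apply, Sum.elim_inl, Pi.single_apply]
      split_ifs <;> norm_num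
    · exact ⟨hL _ _, x k, fun j => by rw [hx]; exact le_add_of_nonneg_left (hL _ _), fun i => le_rfl⟩
  · have hv₂ (i : Fin (r + 1)) : 0 ≤ weight r v i := by
      simpa [homPairing_apply] using hv (.inl i)
    obtain ⟨u, hu⟩ := h (Sum.elim (Sum.elim 0 fun _ => -v (Fin.last (r + 1)))
        (Sum.elim (-(Pᵀ *ᵥ weight r v)) (Pᵀ *ᵥ weight r v))) fun k => by
      have h := hv (.inr k)
      rw [homPairing_apply] at h
      simp only [Sum.elim_inr] at h
      rw [dotProduct_mulVec, ← mulVec_transpose, dotProduct_comm] at h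
      generalize Pᵀ *ᵥ weight r v = d at h
      rw [mulVec]
      simp only [dotProduct, Fintype.sum_sum_type, Sum.elim_inl, Sum.elim_inr, Pi.zero_apply,
        Pi.neg_apply, mul_neg, mul_zero, Finset.sum_neg_distrib, Finset.sum_const_zero,
        Finset.univ_unique, Finset.sum_singleton, x, sub_mul, Finset.sum_sub_distrib] at h ⊢
      simp only [PUnit.default_eq_unit] at h ⊢
      linarith
    refine ⟨hv₁, hv₂, u, ?_, fun j => ?_, ?_⟩
    · funext l
      have h₁ := hu (.inr (.inl l))
      have h₂ := hu (.inr (.inr l))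
      simp only [fromRows_mulVec, Sum.elim_inl, Sum.elim_inr, neg_mulVec, Pi.neg_apply] at h₁ h₂
      linarith
    · simpa [fromRows_mulVec] using hu (.inl (.inl j))
    · have h := hu (.inl (.inr ()))
      simp only [fromRows_mulVec, Sum.elim_inl, Sum.elim_inr] at h
      change 0 ≤ -v (Fin.last (r + 1)) + b ⬝ᵥ u at h
      linarith

end Slice
/-! ### Polar faces -/

section Polar

open Matrix

variable {m n r : ℕ} (P : Matrix (Fin (r + 1)) (Fin n) ℝ) (A : Matrix (Fin m) (Fin n) ℝ)
  (b : Fin m → ℝ)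

/-- The points of the upper image annihilated by `F`. -/
def primalPolar (F : Set (Fin (r + 2) → ℝ)) : Set (Fin (r + 1) → ℝ) :=
  {y | y ∈ upperImage P A b ∧ ∀ v ∈ F, dotSub (weight r v) (v (Fin.last (r + 1))) y = 0}

/-- The points of the slice annihilated by `G`. -/
def dualPolar (G : Set (Fin (r + 1) → ℝ)) : Set (Fin (r + 2) → ℝ) :=
  {v | v ∈ paramSlice P A b ∧ ∀ y ∈ G, (pairing y).toAffineMap v = 0}

variable {P A b}

theorem mem_primalPolar_iff {F : Set (Fin (r + 2) → ℝ)} {y : Fin (r + 1) → ℝ} :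
    y ∈ primalPolar P A b F ↔ y ∈ upperImage P A b ∧ ∀ v ∈ F, pairing y v = 0 := by
  simp only [pairing_apply]
  rfl

theorem mem_dualPolar_iff {G : Set (Fin (r + 1) → ℝ)} {v : Fin (r + 2) → ℝ} :
    v ∈ dualPolar P A b G ↔ v ∈ paramSlice P A b ∧ ∀ y ∈ G, pairing y v = 0 := Iff.rfl

theorem isFace_primalPolar {F : Set (Fin (r + 2) → ℝ)} (hF : F ⊆ paramSlice P A b) :
    IsFace (upperImage P A b) (primalPolar P A b F) :=
  isFace_setOf_forall_eq_zero convex_upperImage F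
    (fun v => dotSub (weight r v) (v (Fin.last (r + 1)))) fun v hv y hy => by
      simpa [pairing_apply] using pairing_nonneg hy (hF hv)

theorem isFace_dualPolar {G : Set (Fin (r + 1) → ℝ)} (hG : G ⊆ upperImage P A b) :
    IsFace (paramSlice P A b) (dualPolar P A b G) :=
  isFace_setOf_forall_eq_zero convex_paramSlice G (fun y => (pairing y).toAffineMap)
    fun _ hy _ hv => pairing_nonneg (hG hy) hv

theorem primalPolar_anti {F₁ F₂ : Set (Fin (r + 2) → ℝ)} (h : F₁ ⊆ F₂) :
    primalPolar P A b F₂ ⊆ primalPolar P A b F₁ :=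
  fun _ hy => ⟨hy.1, fun v hv => hy.2 v (h hv)⟩

theorem subset_dualPolar_primalPolar {F : Set (Fin (r + 2) → ℝ)} (hF : F ⊆ paramSlice P A b) :
    F ⊆ dualPolar P A b (primalPolar P A b F) :=
  fun v hv => mem_dualPolar_iff.2 ⟨hF hv, fun _ hy => (mem_primalPolar_iff.1 hy).2 v hv⟩

theorem subset_primalPolar_dualPolar {G : Set (Fin (r + 1) → ℝ)} (hG : G ⊆ upperImage P A b) :
    G ⊆ primalPolar P A b (dualPolar P A b G) :=
  fun y hy => mem_primalPolar_iff.2 ⟨hG hy, fun _ hv => (mem_dualPolar_iff.1 hv).2 y hy⟩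

/-- Raising $t$ by $\varepsilon$ would make the pairing with a point of `G` equal to $-\varepsilon$.
-/
theorem add_single_notMem_of_mem_dualPolar {G : Set (Fin (r + 1) → ℝ)} (hG : G ⊆ upperImage P A b)
    (hne : G.Nonempty) {v : Fin (r + 2) → ℝ} (hv : v ∈ dualPolar P A b G) {ε : ℝ} (hε : 0 < ε) :
    v + Pi.single (Fin.last (r + 1)) ε ∉ paramSlice P A b := by
  obtain ⟨y, hy⟩ := hne
  intro h
  have h₁ := pairing_nonneg (hG hy) h
  have h₂ : weight r (Pi.single (Fin.last (r + 1)) ε) = 0 := by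
    funext i
    simp [Fin.castSucc_ne_last]
  rw [map_add, (mem_dualPolar_iff.1 hv).2 y hy, pairing_apply, h₂] at h₁
  simp at h₁
  linarith

/-- Subtracting `c` would lower a zero pairing by $w^{\intercal}c$, which is positive because
$w\ge0$ and $e^{\intercal}w=1$. -/
theorem sub_notMem_of_mem_primalPolar {F : Set (Fin (r + 2) → ℝ)} (hF : F ⊆ paramSlice P A b)
    (hne : F.Nonempty) {y : Fin (r + 1) → ℝ} (hy : y ∈ primalPolar P A b F)
    {c : Fin (r + 1) → ℝ} (hc : ∀ i, 0 < c i) : y - c ∉ upperImage P A b := by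
  obtain ⟨v, hv⟩ := hne
  intro h
  have h₁ := pairing_nonneg h (hF hv)
  have h₂ := (mem_primalPolar_iff.1 hy).2 v hv
  obtain ⟨hsum, hw, -⟩ := hF hv
  rw [pairing_apply] at h₁ h₂
  rw [dotProduct_sub] at h₁
  have h₃ : 0 < weight r v ⬝ᵥ c := by
    refine Finset.sum_pos' (fun i _ => mul_nonneg (hw i) (hc i).le) ?_
    by_contra! h₀
    have : ∑ i, weight r v i = 0 := Finset.sum_eq_zero fun i hi => by
      have := h₀ i hi
      nlinarith [hw i, hc i]
    linarith
  linarith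

/-- A face of the upper image has a point around which the upper image is a neighbourhood
relative to the common zeros of the polar face. -/
theorem exists_core_upperImage {G : Set (Fin (r + 1) → ℝ)} (hG : IsFace (upperImage P A b) G)
    (hne : G.Nonempty) :
    ∃ y₀ ∈ G, ∀ y, (∀ v ∈ dualPolar P A b G, pairing y v = 0) →
      ∃ ε > 0, ∀ c : ℝ, |c| ≤ ε → AffineMap.lineMap y₀ y c ∈ upperImage P A b := by
  obtain ⟨K, _, u, w, huw, h⟩ := exists_inequalities_upperImage P A b
  have hweight (k : K) : weight r (Fin.snoc (α := fun _ => ℝ) ((∑ i, w k i)⁻¹ • w k)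
      ((∑ i, w k i)⁻¹ * (b ⬝ᵥ u k))) = (∑ i, w k i)⁻¹ • w k := by
    funext i
    simp
  -- Multipliers with $e^{\intercal}w>0$ become points of the slice after division by
  -- $e^{\intercal}w$.
  have hslice (k : K) (hk : 0 < ∑ i, w k i) :
      Fin.snoc (α := fun _ => ℝ) ((∑ i, w k i)⁻¹ • w k) ((∑ i, w k i)⁻¹ * (b ⬝ᵥ u k)) ∈
        paramSlice P A b := by
    obtain ⟨h₁, h₂, h₃⟩ := huw k
    have hk' := inv_nonneg.2 hk.le
    refine ⟨?_, fun i => ?_, (∑ i, w k i)⁻¹ • u k, ?_, fun j => mul_nonneg hk' (h₂ j), ?_⟩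
    · rw [hweight]
      simp only [Pi.smul_apply, smul_eq_mul, ← Finset.mul_sum]
      exact inv_mul_cancel₀ hk.ne'
    · rw [hweight]
      exact mul_nonneg hk' (h₃ i)
    · rw [hweight, mulVec_smul, mulVec_smul, h₁]
    · simp
  have hpair (k : K) (y : Fin (r + 1) → ℝ) :
      pairing y (Fin.snoc (α := fun _ => ℝ) ((∑ i, w k i)⁻¹ • w k)
        ((∑ i, w k i)⁻¹ * (b ⬝ᵥ u k))) = (∑ i, w k i)⁻¹ * dotSub (w k) (b ⬝ᵥ u k) y := by
    rw [pairing_apply, hweight, smul_dotProduct, Fin.snoc_last, dotSub_apply, smul_eq_mul, mul_sub]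
  have hnonneg (k : K) (y) (hy : y ∈ upperImage P A b) : 0 ≤ dotSub (w k) (b ⬝ᵥ u k) y := by
    obtain ⟨x, hx, hxy⟩ := mem_upperImage_iff.1 hy
    obtain ⟨h₁, h₂, h₃⟩ := huw k
    have h₄ := dotProduct_le_dotProduct_of_nonneg_left hxy h₃
    have h₅ : u k ⬝ᵥ b ≤ u k ⬝ᵥ (A *ᵥ x) := dotProduct_le_dotProduct_of_nonneg_left hx h₂
    have h₆ : w k ⬝ᵥ (P *ᵥ x) = u k ⬝ᵥ (A *ᵥ x) := by
      rw [dotProduct_mulVec, dotProduct_mulVec, ← mulVec_transpose, ← mulVec_transpose, h₁]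
    rw [dotSub_apply, dotProduct_comm b]
    linarith
  have hGM := hG.2.subset
  obtain ⟨y₀, hy₀, hmin⟩ := exists_mem_forall_eq_zero_imp hG.1 hne
    (fun k => dotSub (w k) (b ⬝ᵥ u k)) fun k y hy => hnonneg k y (hGM hy)
  refine ⟨y₀, hy₀, fun y hy => ?_⟩
  obtain ⟨ε, hε, hc⟩ := exists_pos_forall_lineMap_nonneg (fun k => dotSub (w k) (b ⬝ᵥ u k))
    (x₀ := y₀) (x := y) (fun k => hnonneg k y₀ (hGM hy₀)) fun k hk => by
      -- If $e^{\intercal}w=0$, then $w=0$ and the affine function is constant. Otherwise activity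
      -- at `y₀` means activity on all of `G`, so the normalized multiplier lies in the polar face.
      rcases (Finset.sum_nonneg fun i _ => (huw k).2.2 i).eq_or_lt with h₀ | h₀
      · have hw : w k = 0 := by
          funext i
          exact (Finset.sum_eq_zero_iff_of_nonneg fun i _ => (huw k).2.2 i).1 h₀.symm i
            (Finset.mem_univ i)
        simpa [hw] using hk
      · have hmem := hy _ (mem_dualPolar_iff.2 ⟨hslice k h₀, fun y' hy' => by
          rw [hpair, hmin k hk y' hy', mul_zero]⟩)
        rw [hpair] at hmem
        exact (mul_eq_zero.1 hmem).resolve_left (inv_ne_zero h₀.ne')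
  exact ⟨ε, hε, fun c hc' => h _ (hc c hc')⟩

/-- With an empty polar face the condition in `exists_core_upperImage` is vacuous, so one could move
from `y₀` in the direction $-e$ inside $\mathcal{P}$, against weak minimality. -/
theorem dualPolar_nonempty {G : Set (Fin (r + 1) → ℝ)} (hG : IsFace (upperImage P A b) G)
    (hne : G.Nonempty) (hmin : ∀ y ∈ G, ∀ c : Fin (r + 1) → ℝ, (∀ i, 0 < c i) →
      y - c ∉ upperImage P A b) : (dualPolar P A b G).Nonempty := by
  by_contra hempty
  rw [Set.not_nonempty_iff_eq_empty] at hempty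
  obtain ⟨y₀, hy₀, hcore⟩ := exists_core_upperImage hG hne
  obtain ⟨ε, hε, h⟩ := hcore (y₀ - 1) (by simp [hempty])
  refine hmin y₀ hy₀ (fun _ => ε) (fun _ => hε) ?_
  convert h ε (abs_of_pos hε).le using 1
  funext i
  simp [AffineMap.lineMap_apply_module]
  ring

/-- A point of the double polar can be reflected, with contraction, in the core point `y₀` inside
$\mathcal{P}$, so extremality puts it in `G`. -/
theorem primalPolar_dualPolar {G : Set (Fin (r + 1) → ℝ)} (hG : IsFace (upperImage P A b) G)
    (hne : G.Nonempty) : primalPolar P A b (dualPolar P A b G) = G := by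
  refine Set.Subset.antisymm (fun y hy => ?_) (subset_primalPolar_dualPolar hG.2.subset)
  obtain ⟨y₀, hy₀, hcore⟩ := exists_core_upperImage hG hne
  obtain ⟨hy, hy'⟩ := mem_primalPolar_iff.1 hy
  obtain ⟨ε, hε, h⟩ := hcore y hy'
  exact hG.2.mem_of_lineMap_neg_mem hy₀ hy hε (h (-ε) (by rw [abs_neg, abs_of_pos hε]))

/-- A face of the slice that is maximal in the last coordinate has a nonempty polar face, and a
point around which the slice is a neighbourhood relative to the common zeros of the polar face. -/
theorem exists_core_paramSlice {F : Set (Fin (r + 2) → ℝ)} (hF : IsFace (paramSlice P A b) F)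
    (hne : F.Nonempty) (hmax : ∀ v ∈ F, ∀ ε > 0,
      v + Pi.single (Fin.last (r + 1)) ε ∉ paramSlice P A b) :
    (primalPolar P A b F).Nonempty ∧
    ∃ v₀ ∈ F, ∀ v, ∑ i, weight r v i = 1 → (∀ y ∈ primalPolar P A b F, pairing y v = 0) →
      ∃ ε > 0, ∀ c : ℝ, |c| ≤ ε → AffineMap.lineMap v₀ v c ∈ paramSlice P A b := by
  obtain ⟨K, _, y, s, hys, h⟩ := exists_inequalities_paramSlice P A b
  have hFM := hF.2.subset
  obtain ⟨v₀, hv₀, hmin⟩ := exists_mem_forall_eq_zero_imp hF.1 hne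
    (fun k => (homPairing (y k) (s k)).toAffineMap)
    fun k v hv => homPairing_nonneg (hys k) (hFM hv)
  have hcore (v) (hv : ∑ i, weight r v i = 1)
      (hv₀' : ∀ k, homPairing (y k) (s k) v₀ = 0 → homPairing (y k) (s k) v = 0) :
      ∃ ε > 0, ∀ c : ℝ, |c| ≤ ε → AffineMap.lineMap v₀ v c ∈ paramSlice P A b := by
    obtain ⟨ε, hε, hc⟩ := exists_pos_forall_lineMap_nonneg
      (fun k => (homPairing (y k) (s k)).toAffineMap) (x₀ := v₀) (x := v)
      (fun k => homPairing_nonneg (hys k) (hFM hv₀)) hv₀'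
    refine ⟨ε, hε, fun c hc' => h _ ?_ (hc c hc')⟩
    simp only [AffineMap.lineMap_apply_module, map_add, map_smul, Pi.add_apply, Pi.smul_apply,
      smul_eq_mul, Finset.sum_add_distrib, ← Finset.mul_sum, hv, (hFM hv₀).1]
    ring
  -- Inequalities with $s=0$ do not involve $t$. If only such ones were active at `v₀`, then $t$
  -- could be increased there, contradicting `hmax`.
  obtain ⟨k, hk, hsk⟩ : ∃ k, homPairing (y k) (s k) v₀ = 0 ∧ 0 < s k := by
    by_contra! hcon
    have hw : weight r (v₀ + Pi.single (Fin.last (r + 1)) 1) = weight r v₀ := by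
      funext i
      simp [Fin.castSucc_ne_last]
    obtain ⟨ε, hε, hc⟩ := hcore (v₀ + Pi.single (Fin.last (r + 1)) 1) (by rw [hw]; exact (hFM hv₀).1)
      fun k hk => by
        have hs : s k = 0 := le_antisymm (hcon k hk) (hys k).1
        rw [homPairing_apply, hs] at hk ⊢
        rw [hw]
        simpa using hk
    refine hmax v₀ hv₀ ε hε ?_
    convert hc ε (abs_of_pos hε).le using 1
    rw [AffineMap.lineMap_apply, vsub_eq_sub, vadd_eq_add, add_sub_cancel_left,
      ← Pi.single_smul, smul_eq_mul, mul_one, add_comm v₀]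
  have hinv (z : Fin (r + 1) → ℝ) (σ : ℝ) (hσ : 0 < σ) (v) :
      pairing (σ⁻¹ • z) v = σ⁻¹ * homPairing z σ v := by
    rw [pairing_apply, homPairing_apply, dotProduct_smul, smul_eq_mul]
    field_simp
  have hadd (j v) : homPairing (y k + y j) (s k + s j) v =
      homPairing (y k) (s k) v + homPairing (y j) (s j) v := by
    simp only [homPairing_apply, dotProduct_add]
    ring
  have hk₀ : (s k)⁻¹ • y k ∈ primalPolar P A b F :=
    mem_primalPolar_iff.2 ⟨inv_smul_mem_upperImage (hys k) hsk, fun v hv => by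
      rw [hinv _ _ hsk]
      exact mul_eq_zero_of_right _ (hmin k hk v hv)⟩
  refine ⟨⟨_, hk₀⟩, v₀, hv₀, fun v hv hv' => hcore v hv fun j hj => ?_⟩
  -- An active inequality with $s_j=0$ gives no point of $\mathcal{P}$ by itself. Adding the one
  -- with $s_k>0$ allows dehomogenization, and its contribution cancels at the end.
  have hσ : 0 < s k + s j := add_pos_of_pos_of_nonneg hsk (hys j).1
  have h₁ : (s k + s j)⁻¹ • (y k + y j) ∈ primalPolar P A b F :=
    mem_primalPolar_iff.2 ⟨inv_smul_mem_upperImage (add_mem_homUpperImage (hys k) (hys j)) hσ,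
      fun v hv => by
        rw [hinv _ _ hσ, hadd]
        exact mul_eq_zero_of_right _ (add_eq_zero_iff_eq_neg.2 (by
          rw [show homPairing (y k) (s k) v = 0 from hmin k hk v hv,
            show homPairing (y j) (s j) v = 0 from hmin j hj v hv, neg_zero]))⟩
  have h₂ := hv' _ hk₀
  have h₃ := hv' _ h₁
  rw [hinv _ _ hsk, mul_eq_zero, or_iff_right (inv_ne_zero hsk.ne')] at h₂
  rwa [hinv _ _ hσ, mul_eq_zero, or_iff_right (inv_ne_zero hσ.ne'), hadd, h₂, zero_add] at h₃

theorem dualPolar_primalPolar {F : Set (Fin (r + 2) → ℝ)} (hF : IsFace (paramSlice P A b) F)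
    (hne : F.Nonempty) (hmax : ∀ v ∈ F, ∀ ε > 0,
      v + Pi.single (Fin.last (r + 1)) ε ∉ paramSlice P A b) :
    dualPolar P A b (primalPolar P A b F) = F := by
  refine Set.Subset.antisymm (fun v hv => ?_) (subset_dualPolar_primalPolar hF.2.subset)
  obtain ⟨-, v₀, hv₀, hcore⟩ := exists_core_paramSlice hF hne hmax
  obtain ⟨hv, hv'⟩ := mem_dualPolar_iff.1 hv
  obtain ⟨ε, hε, h⟩ := hcore v hv.1 hv'
  exact hF.2.mem_of_lineMap_neg_mem hv₀ hv hε (h (-ε) (by rw [abs_neg, abs_of_pos hε]))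

theorem pairing_eq_zero_of_mem_vectorSpan {F : Set (Fin (r + 2) → ℝ)} {y : Fin (r + 1) → ℝ}
    (h : ∀ v ∈ F, pairing y v = 0) {d : Fin (r + 2) → ℝ} (hd : d ∈ vectorSpan ℝ F) :
    pairing y d = 0 := by
  have : vectorSpan ℝ F ≤ LinearMap.ker (pairing y) := by
    rw [vectorSpan, Submodule.span_le]
    rintro _ ⟨v, hv, v', hv', rfl⟩
    simp [h v hv, h v' hv']
  exact this hd

/-- The direction of a face of the upper image is the orthogonal complement of the weights of the
polar face. -/
theorem mem_vectorSpan_iff {G : Set (Fin (r + 1) → ℝ)} (hG : IsFace (upperImage P A b) G)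
    (hne : G.Nonempty) (d : Fin (r + 1) → ℝ) :
    d ∈ vectorSpan ℝ G ↔
      ∀ w ∈ Submodule.span ℝ (weight r '' dualPolar P A b G), w ⬝ᵥ d = 0 := by
  constructor
  · intro hd w hw
    induction hw using Submodule.span_induction with
    | mem w hw =>
      obtain ⟨v, hv, rfl⟩ := hw
      have : vectorSpan ℝ G ≤ LinearMap.ker (dotProductEquiv ℝ _ (weight r v)) := by
        rw [vectorSpan, Submodule.span_le]
        rintro _ ⟨y, hy, y', hy', rfl⟩
        have h₁ := (mem_dualPolar_iff.1 hv).2 y hy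
        have h₂ := (mem_dualPolar_iff.1 hv).2 y' hy'
        rw [pairing_apply] at h₁ h₂
        show weight r v ⬝ᵥ (y - y') = 0
        rw [dotProduct_sub]
        linarith
      exact this hd
    | zero => simp
    | add w w' _ _ h₁ h₂ => rw [add_dotProduct, h₁, h₂, add_zero]
    | smul c w _ h => rw [smul_dotProduct, h, smul_zero]
  · intro hd
    obtain ⟨y₀, hy₀, hcore⟩ := exists_core_upperImage hG hne
    -- Orthogonality to the weights makes `y₀ + d` a common zero of the polar face, so a segment
    -- around `y₀` in direction `d` lies in $\mathcal{P}$, and extremality keeps it in `G`.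
    obtain ⟨ε, hε, h⟩ := hcore (y₀ + d) fun v hv => by
      have h₁ := (mem_dualPolar_iff.1 hv).2 y₀ hy₀
      have h₂ := hd _ (Submodule.subset_span ⟨v, hv, rfl⟩)
      rw [pairing_apply] at h₁ ⊢
      rw [dotProduct_add]
      linarith
    have h₁ := vsub_mem_vectorSpan ℝ (hG.2.lineMap_mem_of_forall_abs_le hy₀ hε h) hy₀
    rw [AffineMap.lineMap_apply, vsub_eq_sub, vsub_eq_sub, vadd_eq_add, add_sub_cancel_left,
      add_sub_cancel_right] at h₁
    exact (Submodule.smul_mem_iff _ hε.ne').1 h₁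

/-- On `F` the last coordinate is determined by $t=w^{\intercal}y$, so forgetting it preserves the
dimension; the extra one comes from $e^{\intercal}w=1$. -/
theorem finrank_span_weight_image {F : Set (Fin (r + 2) → ℝ)} (hF : F ⊆ paramSlice P A b)
    (hne : F.Nonempty) {y : Fin (r + 1) → ℝ} (hy : ∀ v ∈ F, pairing y v = 0) :
    Module.finrank ℝ (Submodule.span ℝ (weight r '' F)) = setDim F + 1 := by
  rw [finrank_span_eq_finrank_vectorSpan_add_one
    (dotProductEquiv ℝ (Fin (r + 1)) 1) (hne.image _)]
  · have hspan : vectorSpan ℝ (weight r '' F) = (vectorSpan ℝ F).map (weight r) :=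
      ((weight r).toAffineMap.map_vectorSpan (s := F)).symm
    rw [hspan, ← LinearMap.range_domRestrict, LinearMap.finrank_range_of_inj, setDim]
    rw [← LinearMap.ker_eq_bot, LinearMap.ker_eq_bot']
    rintro ⟨d, hd⟩ hd₀
    have hd₁ : weight r d = 0 := hd₀
    have h := pairing_eq_zero_of_mem_vectorSpan hy hd
    rw [pairing_apply, hd₁, zero_dotProduct, zero_sub, neg_eq_zero] at h
    ext i
    refine Fin.lastCases h (fun i => congrFun hd₁ i) i
  · rintro _ ⟨v, hv, rfl⟩
    simpa [dotProduct] using (hF hv).1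

theorem setDim_dualPolar_add_setDim {G : Set (Fin (r + 1) → ℝ)}
    (hG : IsFace (upperImage P A b) G) (hne : G.Nonempty) (hne' : (dualPolar P A b G).Nonempty) :
    setDim (dualPolar P A b G) + setDim G = r := by
  have h₁ := finrank_add_finrank_eq_card_of_mem_iff_dotProduct (mem_vectorSpan_iff hG hne)
  obtain ⟨y, hy⟩ := id hne
  rw [finrank_span_weight_image (fun v hv => hv.1) hne'
    fun v hv => (mem_dualPolar_iff.1 hv).2 y hy, Fintype.card_fin] at h₁
  rw [setDim, setDim] at *
  omega

end Polar

/-! ### Identification of the faces and of the duality maps -/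

section Identification

open Matrix

variable {m n r : ℕ} {P : Matrix (Fin (r + 1)) (Fin n) ℝ} {A : Matrix (Fin m) (Fin n) ℝ}
  {b : Fin m → ℝ}

theorem mem_paramLowerImage_iff {v : Fin (r + 2) → ℝ} :
    v ∈ paramLowerImage P A b ↔ ∃ v' ∈ paramSlice P A b, v ≤ v' := by
  constructor
  · rintro ⟨_, ⟨⟨u, w⟩, ⟨h₁, h₂, h₃, h₄⟩, rfl⟩, c, hc, rfl⟩
    have hw : weight r (paramObjective b (u, w)) = w := by
      funext i
      simp [paramObjective]
    refine ⟨paramObjective b (u, w), ⟨by rw [hw]; exact h₄, by rw [hw]; exact h₃, u,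
      by rw [hw]; exact h₁, h₂, by simp [paramObjective]⟩, fun i => sub_le_self _ (hc i)⟩
  · rintro ⟨v', ⟨h₁, h₂, u, h₃, h₄, h₅⟩, hle⟩
    refine ⟨_, ⟨(u, weight r v'), ⟨h₃, h₄, h₂, h₁⟩, rfl⟩,
      paramObjective b (u, weight r v') - v, fun i => sub_nonneg.2 ((hle i).trans ?_),
      sub_sub_cancel _ _⟩
    refine Fin.lastCases ?_ (fun i => ?_) i
    · simpa [paramObjective] using h₅
    · simp [paramObjective]

theorem paramSlice_subset_paramLowerImage : paramSlice P A b ⊆ paramLowerImage P A b :=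
  fun v hv => mem_paramLowerImage_iff.2 ⟨v, hv, le_rfl⟩

theorem sum_weight_le_one {v : Fin (r + 2) → ℝ} (hv : v ∈ paramLowerImage P A b) :
    ∑ i, weight r v i ≤ 1 := by
  obtain ⟨v', hv', hle⟩ := mem_paramLowerImage_iff.1 hv
  exact (Finset.sum_le_sum fun i _ => hle i.castSucc).trans hv'.1.le

theorem mem_paramSlice_of_sum_weight_eq_one {v : Fin (r + 2) → ℝ} (hv : v ∈ paramLowerImage P A b)
    (h : ∑ i, weight r v i = 1) : v ∈ paramSlice P A b := by
  obtain ⟨v', ⟨h₁, h₂, u, h₃, h₄, h₅⟩, hle⟩ := mem_paramLowerImage_iff.1 hv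
  have hw : weight r v = weight r v' := funext fun i =>
    (Finset.sum_eq_sum_iff_of_le fun i _ => hle (Fin.castSucc i)).1 (h.trans h₁.symm) i
      (Finset.mem_univ i)
  exact ⟨h, hw ▸ h₂, u, hw ▸ h₃, h₄, (hle _).trans h₅⟩

/-- On $\bar{\mathcal{D}}$ the functional $e^{\intercal}w$ is at most $1$, and the slice is where it
equals $1$. -/
theorem isExtreme_paramSlice : IsExtreme ℝ (paramLowerImage P A b) (paramSlice P A b) := by
  refine ⟨paramSlice_subset_paramLowerImage, ?_⟩
  rintro x hx y hy _ hz ⟨c, d, hc, hd, hcd, rfl⟩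
  refine mem_paramSlice_of_sum_weight_eq_one hx (le_antisymm (sum_weight_le_one hx) ?_)
  have h := hz.1
  simp only [map_add, map_smul, Pi.add_apply, Pi.smul_apply, smul_eq_mul,
    Finset.sum_add_distrib, ← Finset.mul_sum] at h
  have := sum_weight_le_one hy
  nlinarith

theorem isConeMaximal_iff {k : ℕ} {M : Set (Fin k → ℝ)} {x : Fin k → ℝ} :
    IsConeMaximal (nonnegOrthant k) M x ↔
      x ∈ M ∧ ∀ c : Fin k → ℝ, (∀ i, 0 ≤ c i) → c ≠ 0 → x + c ∉ M := by
  refine and_congr_right fun _ => ?_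
  rw [Set.eq_empty_iff_forall_notMem]
  constructor
  · intro h c hc hc₀ hx
    refine h (x + c) ⟨⟨x, rfl, -c, ⟨?_, by simpa using hc₀⟩, sub_neg_eq_add x c⟩, hx⟩
    simpa [nonnegOrthant] using hc
  · rintro h _ ⟨⟨_, rfl, c, ⟨hc, hc₀⟩, rfl⟩, hx⟩
    refine h (-c) hc (by simpa using hc₀) ?_
    rwa [← sub_eq_add_neg]

theorem interior_nonnegOrthant (k : ℕ) :
    interior (nonnegOrthant k) = {c : Fin k → ℝ | ∀ i, 0 < c i} := by
  have h : nonnegOrthant k = Set.univ.pi fun _ => Set.Ici 0 := by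
    ext
    simp [nonnegOrthant, Pi.le_def]
  rw [h, interior_pi_set Set.finite_univ]
  ext
  simp

theorem isWeaklyConeMinimal_iff {k : ℕ} {M : Set (Fin k → ℝ)} {x : Fin k → ℝ} :
    IsWeaklyConeMinimal (nonnegOrthant k) M x ↔
      x ∈ M ∧ ∀ c : Fin k → ℝ, (∀ i, 0 < c i) → x - c ∉ M := by
  refine and_congr_right fun _ => ?_
  rw [Set.eq_empty_iff_forall_notMem, interior_nonnegOrthant]
  constructor
  · exact fun h c hc hx => h (x - c) ⟨⟨x, rfl, c, hc, rfl⟩, hx⟩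
  · rintro h _ ⟨⟨_, rfl, c, hc, rfl⟩, hx⟩
    exact h c hc hx

/-- A maximal point coincides with any slice point dominating it, so it lies in the slice.
Conversely, from a slice point an increase within $\bar{\mathcal{D}}$ cannot change $w$, since
$e^{\intercal}w\le1$ there; only $t$ matters. -/
theorem mem_maximalProperFaces_iff {F : Set (Fin (r + 2) → ℝ)} :
    F ∈ maximalProperFaces (nonnegOrthant (r + 2)) (paramLowerImage P A b) ↔
      IsFace (paramSlice P A b) F ∧ F.Nonempty ∧
        ∀ v ∈ F, ∀ ε > 0, v + Pi.single (Fin.last (r + 1)) ε ∉ paramSlice P A b := by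
  simp only [maximalProperFaces, Set.mem_ofPred_eq, isConeMaximal_iff]
  constructor
  · rintro ⟨⟨hF, hne, -⟩, hmax⟩
    have hsub : F ⊆ paramSlice P A b := fun v hv => by
      obtain ⟨v', hv', hle⟩ := mem_paramLowerImage_iff.1 (hmax v hv).1
      have h := (hmax v hv).2 (v' - v) fun i => sub_nonneg.2 (hle i)
      rw [add_sub_cancel, not_imp_not.symm, not_not, not_not] at h
      rwa [← sub_eq_zero.1 (h (paramSlice_subset_paramLowerImage hv'))]
    refine ⟨⟨hF.1, hF.2.mono paramSlice_subset_paramLowerImage hsub⟩, hne, fun v hv ε hε h => ?_⟩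
    refine (hmax v hv).2 (Pi.single (Fin.last (r + 1)) ε) (fun i => ?_) (by simpa using hε.ne')
      (paramSlice_subset_paramLowerImage h)
    rw [Pi.single_apply]
    split_ifs
    exacts [hε.le, le_rfl]
  · rintro ⟨hF, hne, hmax⟩
    refine ⟨⟨⟨hF.1, isExtreme_paramSlice.trans hF.2⟩, hne, ?_⟩, fun v hv =>
      ⟨paramSlice_subset_paramLowerImage (hF.2.subset hv), fun c hc hc₀ h => ?_⟩⟩
    -- Properness is automatic: $\bar{\mathcal{D}}$ is closed under lowering $t$, and a point so
    -- lowered is not maximal.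
    · rintro rfl
      obtain ⟨v, hv⟩ := hne
      obtain ⟨v', hv', hle⟩ := mem_paramLowerImage_iff.1 hv
      refine hmax (v - Pi.single (Fin.last (r + 1)) 1)
        (mem_paramLowerImage_iff.2 ⟨v', hv', le_trans ?_ hle⟩) 1 one_pos ?_
      · exact sub_le_self _ (Pi.single_nonneg.2 zero_le_one)
      · rw [sub_add_cancel]
        exact hF.2.subset hv
    · have hsum := sum_weight_le_one h
      rw [map_add] at hsum
      simp only [Pi.add_apply, Finset.sum_add_distrib, (hF.2.subset hv).1] at hsum
      have hw (i : Fin (r + 1)) : c i.castSucc = 0 :=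
        (Finset.sum_eq_zero_iff_of_nonneg fun i _ => hc (Fin.castSucc i)).1
          (le_antisymm (by simpa using hsum) (Finset.sum_nonneg fun i _ => hc _)) i
          (Finset.mem_univ i)
      have hc' : c = Pi.single (Fin.last (r + 1)) (c (Fin.last (r + 1))) := by
        funext i
        refine Fin.lastCases (by simp) (fun i => ?_) i
        simp [hw, Fin.castSucc_ne_last]
      have hpos : 0 < c (Fin.last (r + 1)) := by
        refine (hc _).lt_of_ne' fun h₀ => hc₀ ?_
        rw [hc', h₀, Pi.single_zero]
      refine hmax v hv _ hpos ?_
      rw [← hc']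
      refine mem_paramSlice_of_sum_weight_eq_one h ?_
      simp [hw]
      exact (hF.2.subset hv).1

theorem mem_weaklyMinimalProperFaces_iff {G : Set (Fin (r + 1) → ℝ)} :
    G ∈ weaklyMinimalProperFaces (nonnegOrthant (r + 1)) (upperImage P A b) ↔
      IsFace (upperImage P A b) G ∧ G.Nonempty ∧
        ∀ y ∈ G, ∀ c : Fin (r + 1) → ℝ, (∀ i, 0 < c i) → y - c ∉ upperImage P A b := by
  simp only [weaklyMinimalProperFaces, Set.mem_ofPred_eq, isWeaklyConeMinimal_iff]
  constructor
  · rintro ⟨⟨hG, hne, -⟩, hmin⟩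
    exact ⟨hG, hne, fun y hy => (hmin y hy).2⟩
  · rintro ⟨hG, hne, hmin⟩
    refine ⟨⟨hG, hne, ?_⟩, fun y hy => ⟨hG.2.subset hy, hmin y hy⟩⟩
    rintro rfl
    obtain ⟨y, hy⟩ := hne
    refine hmin (y + 1) (add_mem_upperImage hy fun _ => zero_le_one) 1 (fun _ => one_pos) ?_
    rwa [add_sub_cancel_right]

/-- On the hyperplane, $1-\sum_{i<q}w_i$ is the dropped coordinate $w_q$. -/
theorem coupling_proj (y : Fin (r + 1) → ℝ) {v : Fin (r + 2) → ℝ} (hv : ∑ i, weight r v i = 1) :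
    coupling y (proj v) = pairing y v := by
  rw [Fin.sum_univ_castSucc] at hv
  simp only [weight_apply] at hv
  rw [pairing_apply, dotProduct, Fin.sum_univ_castSucc]
  simp only [coupling, proj, Fin.snoc_castSucc, Fin.snoc_last, weight_apply, mul_comm]
  rw [← hv]
  ring

theorem proj_mem_lowerImage_iff {v : Fin (r + 2) → ℝ} (hv : ∑ i, weight r v i = 1) :
    proj v ∈ lowerImage P A b ↔ v ∈ paramSlice P A b := by
  constructor
  · rintro ⟨_, ⟨⟨u, w⟩, ⟨h₁, h₂, h₃, h₄⟩, rfl⟩, k, ⟨hk₁, hk₂⟩, heq⟩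
    have hw' (i : Fin r) : w i.castSucc = v i.castSucc.castSucc := by
      have h := congrFun heq i.castSucc
      simpa [geomObjective, proj, hk₁] using h
    have hw : weight r v = w := by
      funext i
      refine Fin.lastCases ?_ (fun i => (hw' i).symm) i
      have h := hv.trans h₄.symm
      rw [Fin.sum_univ_castSucc, Fin.sum_univ_castSucc (f := (u, w).2)] at h
      simpa [hw'] using h
    refine ⟨hv, by rw [hw]; exact h₃, u, by rw [hw]; exact h₁, h₂, ?_⟩
    have h := congrFun heq (Fin.last r)
    simp only [geomObjective, proj, Pi.sub_apply, Fin.snoc_last] at h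
    linarith
  · rintro ⟨-, h₂, u, h₃, h₄, h₅⟩
    refine ⟨_, ⟨(u, weight r v), ⟨h₃, h₄, h₂, hv⟩, rfl⟩, geomObjective b (u, weight r v) - proj v,
      ⟨fun i => ?_, ?_⟩, sub_sub_cancel _ _⟩
    · simp [geomObjective, proj]
    · simpa [geomObjective, proj] using h₅

theorem Psi_PhiInv_eq_primalPolar {F : Set (Fin (r + 2) → ℝ)} (hF : F ⊆ paramSlice P A b) :
    Psi P A b (PhiInv F) = primalPolar P A b F := by
  ext y
  simp only [Psi, PhiInv, primalHyperplane, Set.mem_inter_iff, Set.mem_iInter,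
    Set.forall_mem_image, Set.mem_ofPred_eq, mem_primalPolar_iff, and_comm (b := y ∈ _)]
  exact and_congr_right fun _ => forall₂_congr fun v hv => by rw [coupling_proj y (hF hv).1]

theorem Phi_PsiInv_eq_dualPolar (G : Set (Fin (r + 1) → ℝ)) :
    Phi (PsiInv P A b G) = dualPolar P A b G := by
  ext v
  simp only [Phi, PsiInv, dualHyperplane, Set.mem_inter_iff, Set.mem_preimage, Set.mem_iInter,
    Set.mem_ofPred_eq, mem_dualPolar_iff]
  constructor
  · rintro ⟨⟨h₁, h₂⟩, hv⟩
    exact ⟨(proj_mem_lowerImage_iff hv).1 h₂, fun y hy => by rw [← coupling_proj y hv, h₁ y hy]⟩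
  · rintro ⟨hv, h⟩
    exact ⟨⟨fun y hy => by rw [coupling_proj y hv.1, h y hy], (proj_mem_lowerImage_iff hv.1).2 hv⟩,
      hv.1⟩

end Identification

theorem corollary1 {m n r : ℕ} (P : Matrix (Fin (r + 1)) (Fin n) ℝ)
    (A : Matrix (Fin m) (Fin n) ℝ) (b : Fin m → ℝ) :
    Set.BijOn (Psi P A b ∘ PhiInv)
      (maximalProperFaces (nonnegOrthant (r + 2)) (paramLowerImage P A b))
      (weaklyMinimalProperFaces (nonnegOrthant (r + 1)) (upperImage P A b)) ∧
    (∀ F₁ ∈ maximalProperFaces (nonnegOrthant (r + 2)) (paramLowerImage P A b),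
      ∀ F₂ ∈ maximalProperFaces (nonnegOrthant (r + 2)) (paramLowerImage P A b),
        F₁ ⊆ F₂ → (Psi P A b ∘ PhiInv) F₂ ⊆ (Psi P A b ∘ PhiInv) F₁) ∧
    Set.InvOn (Phi ∘ PsiInv P A b) (Psi P A b ∘ PhiInv)
      (maximalProperFaces (nonnegOrthant (r + 2)) (paramLowerImage P A b))
      (weaklyMinimalProperFaces (nonnegOrthant (r + 1)) (upperImage P A b)) ∧
    ∀ F ∈ maximalProperFaces (nonnegOrthant (r + 2)) (paramLowerImage P A b),
      (setDim F : ℤ) + (setDim ((Psi P A b ∘ PhiInv) F) : ℤ) = ((r + 1 : ℕ) : ℤ) - 1 := by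
  have hpsi {F} (hF : F ∈ maximalProperFaces (nonnegOrthant (r + 2)) (paramLowerImage P A b)) :
      (Psi P A b ∘ PhiInv) F = primalPolar P A b F :=
    Psi_PhiInv_eq_primalPolar (mem_maximalProperFaces_iff.1 hF).1.2.subset
  have hmaps : Set.MapsTo (Psi P A b ∘ PhiInv)
      (maximalProperFaces (nonnegOrthant (r + 2)) (paramLowerImage P A b))
      (weaklyMinimalProperFaces (nonnegOrthant (r + 1)) (upperImage P A b)) := by
    intro F hF
    rw [hpsi hF]
    obtain ⟨hF₁, hF₂, hF₃⟩ := mem_maximalProperFaces_iff.1 hF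
    exact mem_weaklyMinimalProperFaces_iff.2 ⟨isFace_primalPolar hF₁.2.subset,
      (exists_core_paramSlice hF₁ hF₂ hF₃).1,
      fun y hy c hc => sub_notMem_of_mem_primalPolar hF₁.2.subset hF₂ hy hc⟩
  have hmaps' : Set.MapsTo (Phi ∘ PsiInv P A b)
      (weaklyMinimalProperFaces (nonnegOrthant (r + 1)) (upperImage P A b))
      (maximalProperFaces (nonnegOrthant (r + 2)) (paramLowerImage P A b)) := by
    intro G hG
    rw [Function.comp_apply, Phi_PsiInv_eq_dualPolar]
    obtain ⟨hG₁, hG₂, hG₃⟩ := mem_weaklyMinimalProperFaces_iff.1 hG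
    exact mem_maximalProperFaces_iff.2 ⟨isFace_dualPolar hG₁.2.subset,
      dualPolar_nonempty hG₁ hG₂ hG₃,
      fun v hv ε hε => add_single_notMem_of_mem_dualPolar hG₁.2.subset hG₂ hv hε⟩
  have hinv : Set.InvOn (Phi ∘ PsiInv P A b) (Psi P A b ∘ PhiInv)
      (maximalProperFaces (nonnegOrthant (r + 2)) (paramLowerImage P A b))
      (weaklyMinimalProperFaces (nonnegOrthant (r + 1)) (upperImage P A b)) := by
    refine ⟨fun F hF => ?_, fun G hG => ?_⟩
    · obtain ⟨hF₁, hF₂, hF₃⟩ := mem_maximalProperFaces_iff.1 hF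
      rw [hpsi hF, Function.comp_apply, Phi_PsiInv_eq_dualPolar,
        dualPolar_primalPolar hF₁ hF₂ hF₃]
    · obtain ⟨hG₁, hG₂, -⟩ := mem_weaklyMinimalProperFaces_iff.1 hG
      rw [hpsi (hmaps' hG), Function.comp_apply, Phi_PsiInv_eq_dualPolar,
        primalPolar_dualPolar hG₁ hG₂]
  refine ⟨hinv.bijOn hmaps hmaps', fun F₁ h₁ F₂ h₂ h => ?_, hinv, fun F hF => ?_⟩
  · rw [hpsi h₁, hpsi h₂]
    exact primalPolar_anti h
  · rw [hpsi hF]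
    obtain ⟨hF₁, hF₂, hF₃⟩ := mem_maximalProperFaces_iff.1 hF
    -- The dimension formula starts from a face of $\mathcal{P}$, so it is applied to the polar of
    -- `F`, whose own polar is `F` again.
    have hF' := dualPolar_primalPolar hF₁ hF₂ hF₃
    have h := setDim_dualPolar_add_setDim (isFace_primalPolar hF₁.2.subset)
      (exists_core_paramSlice hF₁ hF₂ hF₃).1 (by rwa [hF'])
    rw [hF'] at h
    push_cast
    omega
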